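/- Let $n \ge 0$ and let $\langle\cdot,\cdot\rangle$ be the $\mathbb C$-bilinear extension to $\mathbb C^{3+n}=\mathbb R^{3,n}\otimes\mathbb C$ of the standard symmetric bilinear form of signature $(3,n)$ on $\mathbb R^{3,n}$. Let $$\mathrm{Per} = \mathrm{Gr}_{++}(\mathbb R^{3,n}) = \{[v]\in\mathbb P(\mathbb C^{3+n}) : \langle v,v\rangle = 0,\ \langle v,\bar v\rangle > 0\}$$ be the period space, a complex manifold of dimension $n+1$, being an open subset of the smooth quadric $\{\langle v,v\rangle=0\}\subset\mathbb P(\mathbb C^{3+n})$. Then $\mathrm{Per}$ contains no compact complex submanifold of dimension greater than $1$: if a nonempty compact complex manifold $X$ of (pure) dimension $d$ admits a holomorphic embedding (a holomorphic immersion that is a homeomorphism onto its image) $X\to\mathrm{Per}$, then $d\le 1$. -/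

import Mathlib

open scoped Manifold ContDiff Topology LinearAlgebra.Projectivization

noncomputable section

/-- The quotient topology on the projective space of a topological vector space. -/
instance Projectivization.instTopologicalSpace {K V : Type*} [DivisionRing K] [AddCommGroup V]
    [Module K V] [TopologicalSpace V] : TopologicalSpace (ℙ K V) :=
  TopologicalSpace.coinduced (Projectivization.mk' K) inferInstance

namespace PeriodSpace

/-- The complexification `ℂ^{3+n}` of `ℝ^{3,n}`; the first three coordinates are the positive
directions. Complex conjugation is `star`. -/
abbrev CVec (n : ℕ) : Type := Fin 3 ⊕ Fin n → ℂ

/-- The `ℂ`-bilinear extension of the standard symmetric form of signature `(3, n)`. -/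
def form (n : ℕ) : LinearMap.BilinForm ℂ (CVec n) :=
  LinearMap.mk₂ ℂ
    (fun v w => ∑ i : Fin 3, v (Sum.inl i) * w (Sum.inl i)
      - ∑ j : Fin n, v (Sum.inr j) * w (Sum.inr j))
    (fun a b c => by simp only [Pi.add_apply, add_mul, Finset.sum_add_distrib]; ring)
    (fun t a b => by
      simp only [Pi.smul_apply, smul_eq_mul, mul_assoc, ← Finset.mul_sum]; ring)
    (fun a b c => by simp only [Pi.add_apply, mul_add, Finset.sum_add_distrib]; ring)
    (fun t a b => by
      simp only [Pi.smul_apply, smul_eq_mul, mul_left_comm _ t, ← Finset.mul_sum]; ring)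

variable {n : ℕ}

theorem form_apply (v w : CVec n) :
    form n v w = ∑ i : Fin 3, v (Sum.inl i) * w (Sum.inl i)
      - ∑ j : Fin n, v (Sum.inr j) * w (Sum.inr j) := rfl

theorem form_comm (v w : CVec n) : form n v w = form n w v := by
  simp only [form_apply, mul_comm]

theorem form_star (v w : CVec n) : form n (star v) (star w) = star (form n v w) := by
  simp [form_apply]

/-- Positive null vectors: `⟨v, v⟩ = 0` and `⟨v, v̄⟩ > 0`
(`⟨v, v̄⟩` is automatically a real number). -/
def IsPosNull (v : CVec n) : Prop :=
  form n v v = 0 ∧ 0 < (form n v (star v)).re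

theorem IsPosNull.ne_zero {v : CVec n} (h : IsPosNull v) : v ≠ 0 := by
  rintro rfl
  simpa using h.2

theorem IsPosNull.smul {v : CVec n} (h : IsPosNull v) {t : ℂ} (ht : t ≠ 0) :
    IsPosNull (t • v) := by
  refine ⟨by simp [h.1], ?_⟩
  have h2 : form n (t • v) (star (t • v)) = ((Complex.normSq t : ℝ) : ℂ) * form n v (star v) := by
    rw [star_smul, LinearMap.map_smul₂, map_smul, smul_eq_mul, smul_eq_mul, ← mul_assoc,
      ← Complex.mul_conj]
    rfl
  rw [h2, Complex.re_ofReal_mul]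
  exact mul_pos (Complex.normSq_pos.2 ht) h.2

end PeriodSpace

open PeriodSpace

/-- The period space `Gr₊₊(ℝ^{3,n})`: the set of lines in `ℂ^{3+n}` spanned by positive null
vectors, with the topology induced from the projective space. -/
def PeriodSpace (n : ℕ) : Type :=
  {p : ℙ ℂ (CVec n) // IsPosNull p.rep}

namespace PeriodSpace

variable {n : ℕ}

instance : TopologicalSpace (PeriodSpace n) :=
  inferInstanceAs (TopologicalSpace {p : ℙ ℂ (CVec n) // IsPosNull p.rep})

theorem isPosNull_rep_mk {v : CVec n} (hv : v ≠ 0) :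
    IsPosNull (Projectivization.mk ℂ v hv).rep ↔ IsPosNull v := by
  obtain ⟨a, ha⟩ := Projectivization.exists_smul_eq_mk_rep ℂ v hv
  rw [← ha]
  refine ⟨fun h => ?_, fun h => h.smul a.ne_zero⟩
  have := h.smul (t := ((a⁻¹ : ℂˣ) : ℂ)) (a⁻¹).ne_zero
  rwa [show ((a⁻¹ : ℂˣ) : ℂ) • (a • v) = a⁻¹ • a • v from rfl, inv_smul_smul] at this

/-- The point of the period space spanned by a positive null vector. -/
def mk (v : CVec n) (hv : IsPosNull v) : PeriodSpace n :=
  ⟨Projectivization.mk ℂ v hv.ne_zero, (isPosNull_rep_mk hv.ne_zero).2 hv⟩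

/-- A positive null vector spanning the given line. -/
def rep (p : PeriodSpace n) : CVec n := p.1.rep

theorem isPosNull_rep (p : PeriodSpace n) : IsPosNull p.rep := p.2

theorem mk_rep (p : PeriodSpace n) : mk p.rep p.isPosNull_rep = p :=
  Subtype.ext p.1.mk_rep

theorem exists_rep_mk (v : CVec n) (hv : IsPosNull v) :
    ∃ a : ℂ, a ≠ 0 ∧ (mk v hv).rep = a • v := by
  obtain ⟨a, ha⟩ := Projectivization.exists_smul_eq_mk_rep ℂ v hv.ne_zero
  exact ⟨a, a.ne_zero, ha.symm⟩

theorem mk_eq_mk {v w : CVec n} (hv : IsPosNull v) (hw : IsPosNull w) {a : ℂ} (h : a • w = v) :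
    mk v hv = mk w hw :=
  Subtype.ext ((Projectivization.mk_eq_mk_iff' ℂ v w hv.ne_zero hw.ne_zero).2 ⟨a, h⟩)

theorem isOpenQuotientMap_mk' :
    IsOpenQuotientMap (Projectivization.mk' ℂ : {v : CVec n // v ≠ 0} → ℙ ℂ (CVec n)) := by
  refine ⟨fun p => ⟨⟨p.rep, p.rep_nonzero⟩, p.mk_rep⟩, continuous_coinduced_rng, fun U hU => ?_⟩
  change IsOpen (Projectivization.mk' ℂ ⁻¹' (Projectivization.mk' ℂ '' U))
  have : (Projectivization.mk' ℂ : {v : CVec n // v ≠ 0} → ℙ ℂ (CVec n)) ⁻¹'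
      (Projectivization.mk' ℂ '' U) =
      ⋃ a : ℂˣ, (fun v : {v : CVec n // v ≠ 0} =>
        (⟨a • v.1, (smul_ne_zero_iff_ne a).2 v.2⟩ : {v : CVec n // v ≠ 0})) ⁻¹' U := by
    ext v
    simp only [Set.mem_preimage, Set.mem_image, Set.mem_iUnion]
    constructor
    · rintro ⟨w, hw, h⟩
      obtain ⟨a, ha⟩ := (Projectivization.mk_eq_mk_iff ℂ _ _ w.2 v.2).1 h
      refine ⟨a, ?_⟩
      convert hw using 1
      exact Subtype.ext ha
    · rintro ⟨a, ha⟩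
      exact ⟨_, ha, (Projectivization.mk_eq_mk_iff ℂ _ _ _ v.2).2 ⟨a, rfl⟩⟩
  rw [this]
  refine isOpen_iUnion fun a => hU.preimage ?_
  exact Continuous.subtype_mk (continuous_subtype_val.const_smul a) _

/-- For a positive null vector `w`, coordinates `S` on the orthogonal complement of `w` and `w̄`
and the corresponding coordinates `T` of the orthogonal projection to it. -/
theorem exists_coords (w : CVec n) (hw : IsPosNull w) :
    ∃ (S : EuclideanSpace ℂ (Fin (n + 1)) →L[ℂ] CVec n)
      (T : CVec n →L[ℂ] EuclideanSpace ℂ (Fin (n + 1))),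
      (∀ e, T (S e) = e) ∧ (∀ e, form n (S e) w = 0) ∧ (∀ e, form n (S e) (star w) = 0) ∧
      ∀ v, v = (form n v (star w) / form n w (star w)) • w
        + (form n v w / form n w (star w)) • star w + S (T v) := by
  set c := form n w (star w) with hc
  have hc0 : c ≠ 0 := fun h => by
    have := hw.2
    rw [← hc, h] at this
    simp at this
  have hc' : form n (star w) w = c := by rw [form_comm]
  have hs : form n (star w) (star w) = 0 := by rw [form_star, hw.1, star_zero]
  let f : CVec n →ₗ[ℂ] ℂ × ℂ := ((form n).flip w).prod ((form n).flip (star w))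
  have hf : ∀ v, f v = (form n v w, form n v (star w)) := fun v => rfl
  have hsurj : LinearMap.range f = ⊤ := by
    rw [LinearMap.range_eq_top]
    rintro ⟨a, b⟩
    refine ⟨(b / c) • w + (a / c) • star w, ?_⟩
    rw [hf]
    simp only [map_add, map_smul, LinearMap.add_apply, LinearMap.smul_apply, smul_eq_mul, hw.1, hs,
      hc', ← hc, mul_zero, zero_add, add_zero, div_mul_cancel₀ _ hc0]
  have hrank : Module.finrank ℂ (LinearMap.ker f) = n + 1 := by
    have h1 := LinearMap.finrank_range_add_finrank_ker f
    rw [hsurj, finrank_top, Module.finrank_prod, Module.finrank_self, Module.finrank_pi,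
      Fintype.card_sum, Fintype.card_fin, Fintype.card_fin] at h1
    omega
  let L : EuclideanSpace ℂ (Fin (n + 1)) ≃ₗ[ℂ] LinearMap.ker f :=
    LinearEquiv.ofFinrankEq _ _ (by rw [finrank_euclideanSpace_fin, hrank])
  let P₀ : CVec n →ₗ[ℂ] CVec n := LinearMap.id
    - (c⁻¹ • ((form n).flip (star w))).smulRight w - (c⁻¹ • ((form n).flip w)).smulRight (star w)
  have hP₀ : ∀ v, P₀ v = v - (c⁻¹ * form n v (star w)) • w - (c⁻¹ * form n v w) • star w :=
    fun v => rfl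
  have hP₀mem : ∀ v, P₀ v ∈ LinearMap.ker f := by
    intro v
    rw [LinearMap.mem_ker, hf, hP₀]
    simp only [map_sub, map_smul, LinearMap.sub_apply, LinearMap.smul_apply, smul_eq_mul, hw.1, hs,
      hc', ← hc, mul_zero, sub_zero]
    ext <;> simp <;> field_simp <;> ring
  let P : CVec n →ₗ[ℂ] LinearMap.ker f := P₀.codRestrict _ hP₀mem
  have hker : ∀ e, form n (L e : CVec n) w = 0 ∧ form n (L e : CVec n) (star w) = 0 := by
    intro e
    have := (L e).2
    rw [LinearMap.mem_ker, hf, Prod.mk_eq_zero] at this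
    exact this
  refine ⟨LinearMap.toContinuousLinearMap ((LinearMap.ker f).subtype ∘ₗ L.toLinearMap),
    LinearMap.toContinuousLinearMap (L.symm.toLinearMap ∘ₗ P), ?_, ?_, ?_, ?_⟩
  · intro e
    have : P (L e : CVec n) = L e := by
      apply Subtype.ext
      change P₀ (L e : CVec n) = _
      rw [hP₀, (hker e).1, (hker e).2]
      simp
    simp [this]
  · exact fun e => (hker e).1
  · exact fun e => (hker e).2
  · intro v
    have : (LinearMap.toContinuousLinearMap ((LinearMap.ker f).subtype ∘ₗ L.toLinearMap))
        ((LinearMap.toContinuousLinearMap (L.symm.toLinearMap ∘ₗ P)) v) = P₀ v := by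
      simp [P]
    rw [this, hP₀, div_eq_inv_mul, div_eq_inv_mul]
    abel

/-- Linear coordinates `ℂ^{n+1} → {p, p̄}^⊥`. -/
def coordS (p : PeriodSpace n) : EuclideanSpace ℂ (Fin (n + 1)) →L[ℂ] CVec n :=
  (exists_coords p.rep p.isPosNull_rep).choose

/-- The orthogonal projection to `{p, p̄}^⊥` followed by the inverse of `coordS p`. -/
def coordT (p : PeriodSpace n) : CVec n →L[ℂ] EuclideanSpace ℂ (Fin (n + 1)) :=
  (exists_coords p.rep p.isPosNull_rep).choose_spec.choose

theorem coords_spec (p : PeriodSpace n) :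
    (∀ e, coordT p (coordS p e) = e) ∧ (∀ e, form n (coordS p e) p.rep = 0) ∧
    (∀ e, form n (coordS p e) (star p.rep) = 0) ∧
    ∀ v, v = (form n v (star p.rep) / form n p.rep (star p.rep)) • p.rep
        + (form n v p.rep / form n p.rep (star p.rep)) • star p.rep + coordS p (coordT p v) :=
  (exists_coords p.rep p.isPosNull_rep).choose_spec.choose_spec

/-- The holomorphic parametrization of the null vectors `v` with `⟨v, p̄⟩ = 1` inverse to the
projection to `{p, p̄}^⊥` (stereographic projection of the quadric). -/
def param (p : PeriodSpace n) (e : EuclideanSpace ℂ (Fin (n + 1))) : CVec n :=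
  (form n p.rep (star p.rep))⁻¹ • p.rep
    - (form n (coordS p e) (coordS p e) / 2) • star p.rep + coordS p e

/-- The affine coordinate map `[v] ↦ T v / ⟨v, p̄⟩`. -/
def coord (p : PeriodSpace n) (v : CVec n) : EuclideanSpace ℂ (Fin (n + 1)) :=
  (form n v (star p.rep))⁻¹ • coordT p v

theorem coord_smul (p : PeriodSpace n) (v : CVec n) {a : ℂ} (ha : a ≠ 0) :
    coord p (a • v) = coord p v := by
  simp only [coord, map_smul, LinearMap.smul_apply, smul_eq_mul, smul_smul, mul_inv]
  congr 1
  field_simp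

theorem form_rep_ne_zero (p : PeriodSpace n) : form n p.rep (star p.rep) ≠ 0 := fun h => by
  have := p.isPosNull_rep.2
  rw [h] at this
  simp at this

theorem form_star_rep (p : PeriodSpace n) : form n (star p.rep) (star p.rep) = 0 := by
  rw [form_star, p.isPosNull_rep.1, star_zero]

theorem form_param (p : PeriodSpace n) (e : EuclideanSpace ℂ (Fin (n + 1))) :
    form n (param p e) (star p.rep) = 1 := by
  simp only [param, map_add, map_sub, map_smul, LinearMap.add_apply, LinearMap.sub_apply,
    LinearMap.smul_apply, smul_eq_mul, form_star_rep, (coords_spec p).2.2.1, mul_zero, sub_zero,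
    add_zero]
  exact inv_mul_cancel₀ (form_rep_ne_zero p)

theorem form_param_param (p : PeriodSpace n) (e : EuclideanSpace ℂ (Fin (n + 1))) :
    form n (param p e) (param p e) = 0 := by
  have h1 : form n p.rep (coordS p e) = 0 := by rw [form_comm, (coords_spec p).2.1]
  have h2 : form n (star p.rep) (coordS p e) = 0 := by rw [form_comm, (coords_spec p).2.2.1]
  have h3 : form n (star p.rep) p.rep = form n p.rep (star p.rep) := form_comm _ _
  have h0 := form_rep_ne_zero p
  simp only [param, map_add, map_sub, map_smul, LinearMap.add_apply, LinearMap.sub_apply,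
    LinearMap.smul_apply, smul_eq_mul, form_star_rep, (coords_spec p).2.2.1, (coords_spec p).2.1,
    h1, h2, h3, p.isPosNull_rep.1]
  field_simp
  ring

theorem coordT_rep (p : PeriodSpace n) : coordT p p.rep = 0 := by
  have h := (coords_spec p).2.2.2 p.rep
  rw [div_self (form_rep_ne_zero p), p.isPosNull_rep.1, zero_div, zero_smul, one_smul, add_zero]
    at h
  have h2 : coordS p (coordT p p.rep) = 0 := by simpa using h
  rw [← (coords_spec p).1 (coordT p p.rep), h2, map_zero]

theorem coordT_star_rep (p : PeriodSpace n) : coordT p (star p.rep) = 0 := by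
  have h := (coords_spec p).2.2.2 (star p.rep)
  rw [form_star_rep, form_comm (star p.rep) p.rep, div_self (form_rep_ne_zero p), zero_div, zero_smul, one_smul,
    zero_add] at h
  have h2 : coordS p (coordT p (star p.rep)) = 0 := by simpa using h
  rw [← (coords_spec p).1 (coordT p (star p.rep)), h2, map_zero]

theorem coord_param (p : PeriodSpace n) (e : EuclideanSpace ℂ (Fin (n + 1))) :
    coord p (param p e) = e := by
  rw [coord, form_param, inv_one, one_smul, param]
  simp only [map_add, map_sub, map_smul, coordT_rep, coordT_star_rep, smul_zero, sub_zero,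
    zero_add, (coords_spec p).1]

theorem param_coord (p : PeriodSpace n) {v : CVec n} (hv : form n v v = 0)
    (h : form n v (star p.rep) ≠ 0) :
    param p (coord p v) = (form n v (star p.rep))⁻¹ • v := by
  set u : CVec n := (form n v (star p.rep))⁻¹ • v with hu
  have hu1 : form n u (star p.rep) = 1 := by
    rw [hu, map_smul, LinearMap.smul_apply, smul_eq_mul, inv_mul_cancel₀ h]
  have hu0 : form n u u = 0 := by simp [hu, hv]
  have hc : coord p v = coordT p u := by rw [coord, hu, map_smul]
  have h0 := form_rep_ne_zero p
  have hdec := (coords_spec p).2.2.2 u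
  rw [hu1] at hdec
  rw [hc, param]
  set s := coordS p (coordT p u) with hs
  have h1 : form n p.rep s = 0 := by rw [form_comm, (coords_spec p).2.1]
  have h2 : form n (star p.rep) s = 0 := by rw [form_comm, (coords_spec p).2.2.1]
  have h1' : form n s p.rep = 0 := (coords_spec p).2.1 _
  have h2' : form n s (star p.rep) = 0 := (coords_spec p).2.2.1 _
  have h3 : form n (star p.rep) p.rep = form n p.rep (star p.rep) := form_comm _ _
  set b := form n u p.rep / form n p.rep (star p.rep) with hb
  have key : form n s s / 2 = -b := by
    rw [hdec] at hu0
    simp only [map_add, map_smul, LinearMap.add_apply, LinearMap.smul_apply, smul_eq_mul,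
      form_star_rep, h1, h2, h1', h2', h3, p.isPosNull_rep.1] at hu0
    have h4 : 1 / form n p.rep (star p.rep) * form n p.rep (star p.rep) = 1 := by
      rw [one_div, inv_mul_cancel₀ h0]
    linear_combination (1 / 2 : ℂ) * hu0 - b * h4
  rw [key]
  conv_rhs => rw [hdec]
  rw [one_div, neg_smul, sub_neg_eq_add]

theorem contDiff_form : ContDiff ℂ ω (fun x : CVec n × CVec n => form n x.1 x.2) := by
  simp only [form_apply]
  fun_prop

theorem contDiff_param (p : PeriodSpace n) : ContDiff ℂ ω (param p) := by
  have hS : ContDiff ℂ ω (coordS p) := (coordS p).contDiff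
  have hB : ContDiff ℂ ω (fun e => form n (coordS p e) (coordS p e)) :=
    ContDiff.comp (g := fun x : CVec n × CVec n => form n x.1 x.2)
      (f := fun e => (coordS p e, coordS p e)) contDiff_form (hS.prodMk hS)
  exact (contDiff_const.sub ((hB.div_const 2).smul contDiff_const)).add hS

theorem contDiffAt_coord (p : PeriodSpace n) {v : CVec n} (h : form n v (star p.rep) ≠ 0) :
    ContDiffAt ℂ ω (coord p) v := by
  have hB : ContDiff ℂ ω (fun v => form n v (star p.rep)) :=
    contDiff_form.comp (contDiff_id.prodMk contDiff_const)
  exact (hB.contDiffAt.inv h).smul (coordT p).contDiff.contDiffAt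

theorem isOpen_pos : IsOpen {v : CVec n | 0 < (form n v (star v)).re} := by
  refine isOpen_lt continuous_const (Complex.continuous_re.comp ?_)
  exact contDiff_form.continuous.comp (continuous_id.prodMk continuous_star)

open Classical in
/-- The chart of the period space around `p`: stereographic projection of the quadric. -/
def chart (p : PeriodSpace n) :
    OpenPartialHomeomorph (PeriodSpace n) (EuclideanSpace ℂ (Fin (n + 1))) where
  toFun q := coord p q.rep
  invFun e := if h : IsPosNull (param p e) then mk (param p e) h else p
  source := {q | form n q.rep (star p.rep) ≠ 0}
  target := {e | 0 < (form n (param p e) (star (param p e))).re}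
  map_source' := by
    intro q hq
    change 0 < (form n (param p (coord p q.rep)) (star (param p (coord p q.rep)))).re
    rw [param_coord p q.isPosNull_rep.1 hq]
    exact (q.isPosNull_rep.smul (inv_ne_zero hq)).2
  map_target' := by
    intro e he
    have h : IsPosNull (param p e) := ⟨form_param_param p e, he⟩
    rw [dif_pos h]
    obtain ⟨a, ha, h2⟩ := exists_rep_mk _ h
    change form n (mk _ h).rep _ ≠ 0
    rw [h2, map_smul, LinearMap.smul_apply, form_param]
    simpa using ha
  left_inv' := by
    intro q hq
    have h1 := param_coord p q.isPosNull_rep.1 hq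
    have h : IsPosNull (param p (coord p q.rep)) := by
      rw [h1]; exact q.isPosNull_rep.smul (inv_ne_zero hq)
    rw [dif_pos h]
    conv_rhs => rw [← q.mk_rep]
    exact mk_eq_mk _ _ h1.symm
  right_inv' := by
    intro e he
    have h : IsPosNull (param p e) := ⟨form_param_param p e, he⟩
    rw [dif_pos h]
    obtain ⟨a, ha, h2⟩ := exists_rep_mk _ h
    rw [h2, coord_smul _ _ ha, coord_param]
  open_source := by
    have : IsOpen {q : ℙ ℂ (CVec n) | form n q.rep (star p.rep) ≠ 0} := by
      rw [← isOpenQuotientMap_mk'.isQuotientMap.isOpen_preimage]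
      have h2 : (Projectivization.mk' ℂ : {v : CVec n // v ≠ 0} → ℙ ℂ (CVec n)) ⁻¹'
          {q : ℙ ℂ (CVec n) | form n q.rep (star p.rep) ≠ 0} =
          {v | form n v.1 (star p.rep) ≠ 0} := by
        ext v
        obtain ⟨a, ha⟩ := Projectivization.exists_smul_eq_mk_rep ℂ v.1 v.2
        change form n (Projectivization.mk ℂ v.1 v.2).rep _ ≠ 0 ↔ _
        rw [← ha, Units.smul_def, map_smul, LinearMap.smul_apply]
        simp
      rw [h2]
      exact isOpen_ne_fun (contDiff_form.continuous.comp
        (continuous_subtype_val.prodMk continuous_const)) continuous_const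
    exact this.preimage continuous_subtype_val
  open_target := isOpen_pos.preimage (contDiff_param p).continuous
  continuousOn_toFun := by
    intro q hq
    apply ContinuousAt.continuousWithinAt
    have h1 : ContinuousAt (fun x : ℙ ℂ (CVec n) => coord p x.rep)
        (Projectivization.mk' ℂ ⟨q.rep, q.isPosNull_rep.ne_zero⟩) := by
      rw [← isOpenQuotientMap_mk'.continuousAt_comp_iff]
      have h2 : (fun x : ℙ ℂ (CVec n) => coord p x.rep) ∘ Projectivization.mk' ℂ =
          fun v : {v : CVec n // v ≠ 0} => coord p v.1 := by
        funext v
        obtain ⟨a, ha⟩ := Projectivization.exists_smul_eq_mk_rep ℂ v.1 v.2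
        change coord p (Projectivization.mk ℂ v.1 v.2).rep = _
        rw [← ha, Units.smul_def, coord_smul _ _ a.ne_zero]
      rw [h2]
      exact (contDiffAt_coord p hq).continuousAt.comp (f := Subtype.val)
        continuous_subtype_val.continuousAt
    have h3 : Projectivization.mk' ℂ ⟨q.rep, q.isPosNull_rep.ne_zero⟩ = q.1 := q.1.mk_rep
    rw [h3] at h1
    exact h1.comp (f := Subtype.val) continuous_subtype_val.continuousAt
  continuousOn_invFun := by
    have h1 : ContinuousOn (fun e => if h : IsPosNull (param p e) then mk (param p e) h else p)
        {e | IsPosNull (param p e)} := by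
      rw [continuousOn_iff_continuous_domRestrict]
      refine Continuous.congr (f := fun e : {e | IsPosNull (param p e)} =>
        mk (param p e.1) e.2) ?_ ?_
      · refine Continuous.subtype_mk ?_ _
        exact isOpenQuotientMap_mk'.continuous.comp (Continuous.subtype_mk
          ((contDiff_param p).continuous.comp continuous_subtype_val)
          fun e => IsPosNull.ne_zero e.2)
      · intro e
        exact (dif_pos e.2).symm
    exact h1.mono fun e he => ⟨form_param_param p e, he⟩

theorem chart_symm_apply (p : PeriodSpace n) {e : EuclideanSpace ℂ (Fin (n + 1))}
    (h : IsPosNull (param p e)) : (chart p).symm e = mk (param p e) h :=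
  dif_pos h

instance : ChartedSpace (EuclideanSpace ℂ (Fin (n + 1))) (PeriodSpace n) where
  atlas := Set.range chart
  chartAt := chart
  mem_chart_source p := form_rep_ne_zero p
  chart_mem_atlas p := ⟨p, rfl⟩

/-- The charts are holomorphically compatible: the period space is a complex manifold of
dimension `n + 1`. -/
instance : IsManifold 𝓘(ℂ, EuclideanSpace ℂ (Fin (n + 1))) ω (PeriodSpace n) := by
  apply isManifold_of_contDiffOn
  rintro _ _ ⟨p, rfl⟩ ⟨q, rfl⟩ e he
  have he' : e ∈ (chart p).target ∧ (chart p).symm e ∈ (chart q).source := by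
    simpa [OpenPartialHomeomorph.trans_source] using he
  have hpos : ∀ x ∈ (chart p).target, IsPosNull (param p x) :=
    fun x hx => ⟨form_param_param p x, hx⟩
  have heq : ∀ x ∈ (chart p).target, (chart q) ((chart p).symm x) = coord q (param p x) := by
    intro x hx
    obtain ⟨a, ha, h2⟩ := exists_rep_mk _ (hpos x hx)
    rw [chart_symm_apply p (hpos x hx)]
    change coord q (mk _ _).rep = _
    rw [h2, coord_smul _ _ ha]
  have hne : form n (param p e) (star q.rep) ≠ 0 := by
    have h1 := he'.2
    rw [chart_symm_apply p (hpos e he'.1)] at h1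
    obtain ⟨a, ha, h2⟩ := exists_rep_mk _ (hpos e he'.1)
    change form n (mk _ _).rep _ ≠ 0 at h1
    rw [h2, map_smul, LinearMap.smul_apply] at h1
    exact right_ne_zero_of_mul h1
  have hcd : ContDiffAt ℂ ω (fun x => coord q (param p x)) e :=
    (contDiffAt_coord q hne).comp e (contDiff_param p).contDiffAt
  refine (hcd.congr_of_eventuallyEq ?_).contDiffWithinAt
  filter_upwards [(chart p).open_target.mem_nhds he'.1] with x hx
  exact heq x hx

end PeriodSpace

end

/-! Forgetting all but two of the three positive coordinates gives a holomorphic map π from the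
period space to the projective line. It is defined everywhere, because a null vector with at most
one nonzero positive coordinate cannot satisfy ⟨v, v̄⟩ > 0 (`IsPosNull.posPair_ne_zero`).

The function log (‖v‖² / ‖π v‖²) descends to the period space, and its Levi form is the Fubini–Study
form of the ambient projective space minus the pullback of that of the line. Hence it is positive on
nonzero tangent vectors killed by dπ. On a compact X the function attains a maximum, where its Levi
form is nonpositive in every direction tangent to X. If d ≥ 2, then dπ has a nonzero kernel on the
tangent space of X at that point, a contradiction.

Only a single point and a single tangent direction matter, so no fibre of π has to be studied. In
`deriv_mem_span_of_norm_ratio_le` the second-order argument is replaced by the maximum modulus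
principle in one variable. `Manifold.IsImmersionAt.exists_hasFDerivAt_injective` supplies the
tangent directions of X in a chart of the period space. -/

/-! ### Norm ratios of holomorphic curves and the maximum principle -/

/-- Pythagoras for `x` and its orthogonal projection to the line spanned by `a`. -/
theorem norm_sq_eq_add_norm_sub_sq {E : Type*} [NormedAddCommGroup E] [InnerProductSpace ℂ E]
    {a : E} (ha : a ≠ 0) (x : E) :
    ‖x‖ ^ 2 = ‖inner ℂ a x / (‖a‖ : ℂ) ^ 2‖ ^ 2 * ‖a‖ ^ 2
      + ‖x - (inner ℂ a x / (‖a‖ : ℂ) ^ 2) • a‖ ^ 2 := by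
  set c := inner ℂ a x / (‖a‖ : ℂ) ^ 2 with hc
  have h0 : (‖a‖ : ℂ) ^ 2 ≠ 0 := by simpa using ha
  have horth : inner ℂ (c • a) (x - c • a) = 0 := by
    rw [inner_smul_left, inner_sub_right, inner_smul_right, inner_self_eq_norm_sq_to_K]
    have : inner ℂ a x = c * (‖a‖ : ℂ) ^ 2 := by
      rw [hc, div_mul_cancel₀ _ h0]
    rw [this]
    simp
  have := norm_add_sq_eq_norm_sq_add_norm_sq_of_inner_eq_zero (c • a) (x - c • a) horth
  rw [add_sub_cancel] at this
  rw [pow_two ‖x‖, this, norm_smul]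
  ring

/-- Holomorphic curves `v`, `u` in inner product spaces for which `‖v‖ / ‖u‖` is maximal at `0`
cannot have `u` stationary and `v` nonstationary, in the projective sense, at `0`. -/
theorem deriv_mem_span_of_norm_ratio_le {E F : Type*} [NormedAddCommGroup E]
    [InnerProductSpace ℂ E] [NormedAddCommGroup F] [InnerProductSpace ℂ F]
    {v : ℂ → E} {u : ℂ → F} {v' : E} {u' : F}
    (hv : ∀ᶠ z in 𝓝 0, DifferentiableAt ℂ v z) (hu : ∀ᶠ z in 𝓝 0, DifferentiableAt ℂ u z)
    (hv' : HasDerivAt v v' 0) (hu' : HasDerivAt u u' 0) (hv0 : v 0 ≠ 0) (hu0 : u 0 ≠ 0)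
    (hspan : u' ∈ Submodule.span ℂ {u 0})
    (hle : ∀ᶠ z in 𝓝 0, ‖v z‖ * ‖u 0‖ ≤ ‖v 0‖ * ‖u z‖) :
    v' ∈ Submodule.span ℂ {v 0} := by
  by_contra hnot
  have hV : 0 < ‖v 0‖ := norm_pos_iff.2 hv0
  have hU : 0 < ‖u 0‖ := norm_pos_iff.2 hu0
  have hVc : (‖v 0‖ : ℂ) ^ 2 ≠ 0 := by simpa using hv0
  have hUc : (‖u 0‖ : ℂ) ^ 2 ≠ 0 := by simpa using hu0
  let A : E →L[ℂ] ℂ := ((‖v 0‖ : ℂ) ^ 2)⁻¹ • innerSL ℂ (v 0)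
  let B : F →L[ℂ] ℂ := ((‖u 0‖ : ℂ) ^ 2)⁻¹ • innerSL ℂ (u 0)
  have hA : ∀ x, A x = inner ℂ (v 0) x / (‖v 0‖ : ℂ) ^ 2 := fun x => by
    simp [A, div_eq_inv_mul]
  have hB : ∀ x, B x = inner ℂ (u 0) x / (‖u 0‖ : ℂ) ^ 2 := fun x => by
    simp [B, div_eq_inv_mul]
  have hA0 : A (v 0) = 1 := by
    rw [hA, inner_self_eq_norm_sq_to_K]; exact div_self hVc
  have hB0 : B (u 0) = 1 := by
    rw [hB, inner_self_eq_norm_sq_to_K]; exact div_self hUc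
  -- The components of `v` and `u` orthogonal to their values at `0`. Their derivatives at `0` are
  -- the projective velocities: nonzero for `p`, zero for `q`.
  let p : ℂ → E := fun z => v z - A (v z) • v 0
  let q : ℂ → F := fun z => u z - B (u z) • u 0
  have hp0 : p 0 = 0 := by simp [p, hA0]
  have hq0 : q 0 = 0 := by simp [q, hB0]
  have hp : HasDerivAt p (v' - A v' • v 0) 0 :=
    hv'.sub ((A.hasFDerivAt.comp_hasDerivAt 0 hv').smul_const _)
  have hq : HasDerivAt q (u' - B u' • u 0) 0 :=
    hu'.sub ((B.hasFDerivAt.comp_hasDerivAt 0 hu').smul_const _)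
  have hp' : v' - A v' • v 0 ≠ 0 := fun h => hnot
    (Submodule.mem_span_singleton.2 ⟨A v', (sub_eq_zero.1 h).symm⟩)
  have hq' : u' - B u' • u 0 = 0 := by
    obtain ⟨t, rfl⟩ := Submodule.mem_span_singleton.1 hspan
    simp [hB0]
  rw [hq'] at hq
  -- Both components vanish at `0`, so the slopes tend to the derivatives: ‖q z‖ is o(|z|), while ‖p
  -- z‖ is bounded below by a multiple of |z|.
  have hlt : ∀ᶠ z in 𝓝[≠] (0 : ℂ), ‖v 0‖ * ‖q z‖ < ‖u 0‖ * ‖p z‖ := by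
    have h1 := (hq.tendsto_slope.norm).const_mul ‖v 0‖
    have h2 := (hp.tendsto_slope.norm).const_mul ‖u 0‖
    have h3 := h1.eventually_lt h2 (by
      rw [norm_zero, mul_zero]; exact mul_pos hU (norm_pos_iff.2 hp'))
    filter_upwards [h3, self_mem_nhdsWithin] with z hz hz0
    have hz0 : 0 < ‖z‖ := norm_pos_iff.2 hz0
    simp only [slope, vsub_eq_sub, sub_zero, hp0, hq0, norm_smul, norm_inv] at hz
    rw [mul_left_comm, mul_left_comm ‖u 0‖] at hz
    exact lt_of_mul_lt_mul_left hz (inv_nonneg.2 hz0.le)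
  have hbne : ∀ᶠ z in 𝓝 0, B (u z) ≠ 0 := by
    have hc : ContinuousAt (fun z => B (u z)) 0 :=
      B.continuous.continuousAt.comp hu'.continuousAt
    exact hc.eventually_ne (by rw [hB0]; exact one_ne_zero)
  -- Expand both sides of the squared inequality `hle` by Pythagoras. Since the orthogonal part of
  -- `v` strictly dominates that of `u`, the parallel part must be strictly smaller.
  have hab : ∀ᶠ z in 𝓝[≠] (0 : ℂ), ‖A (v z)‖ < ‖B (u z)‖ := by
    filter_upwards [hlt, hle.filter_mono nhdsWithin_le_nhds] with z h1 h2
    have e1 := norm_sq_eq_add_norm_sub_sq hv0 (v z)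
    have e2 := norm_sq_eq_add_norm_sub_sq hu0 (u z)
    rw [← hA] at e1
    rw [← hB] at e2
    change _ = _ + ‖p z‖ ^ 2 at e1
    change _ = _ + ‖q z‖ ^ 2 at e2
    have h3 := pow_le_pow_left₀ (by positivity) h2 2
    have h4 := pow_lt_pow_left₀ h1 (by positivity) two_ne_zero
    rw [mul_pow, mul_pow, e1, e2] at h3
    rw [mul_pow, mul_pow] at h4
    have h5 : (‖u 0‖ ^ 2 * ‖v 0‖ ^ 2) * ‖A (v z)‖ ^ 2 <
      (‖u 0‖ ^ 2 * ‖v 0‖ ^ 2) * ‖B (u z)‖ ^ 2 := by linarith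
    exact lt_of_pow_lt_pow_left₀ 2 (norm_nonneg _) (lt_of_mul_lt_mul_left h5 (by positivity))
  -- This quotient is holomorphic near `0`, equals 1 there and has modulus below 1 at all other
  -- nearby points, which the maximum modulus principle forbids.
  let h : ℂ → ℂ := fun z => A (v z) / B (u z)
  have hh0 : h 0 = 1 := by simp [h, hA0, hB0]
  have hd : ∀ᶠ z in 𝓝 0, DifferentiableAt ℂ h z := by
    filter_upwards [hv, hu, hbne] with z h1 h2 h3
    exact (A.differentiableAt.comp z h1).div (B.differentiableAt.comp z h2) h3
  have hlt1 : ∀ᶠ z in 𝓝[≠] (0 : ℂ), ‖h z‖ < 1 := by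
    filter_upwards [hab] with z hz
    rw [norm_div]
    exact (div_lt_one ((norm_nonneg _).trans_lt hz)).2 hz
  have hmax : IsLocalMax (norm ∘ h) 0 := by
    filter_upwards [eventually_nhdsWithin_iff.1 hlt1] with z hz
    rcases eq_or_ne z 0 with rfl | hz0
    · exact le_rfl
    · simpa [hh0] using (hz hz0).le
  have hconst := (Complex.eventually_eq_of_isLocalMax_norm hd hmax).filter_mono
    (nhdsWithin_le_nhds (s := {0}ᶜ))
  obtain ⟨z, h1, h2⟩ := (hlt1.and hconst).exists
  rw [h2, hh0, norm_one] at h1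
  exact lt_irrefl _ h1

/-! ### Immersions read in the preferred chart of the target -/

/-- An immersion admits a local parametrization of its source in which, read in a chart of the
target, it is differentiable with injective derivative. -/
theorem Manifold.IsImmersionAt.exists_hasFDerivAt_injective {𝕜 E E' M N : Type*}
    [NontriviallyNormedField 𝕜]
    [NormedAddCommGroup E] [NormedSpace 𝕜 E] [NormedAddCommGroup E'] [NormedSpace 𝕜 E']
    [TopologicalSpace M] [ChartedSpace E M] [TopologicalSpace N] [ChartedSpace E' N]
    [IsManifold 𝓘(𝕜, E') ω N] {f : M → N} {x : M}
    (hf : IsImmersionAt 𝓘(𝕜, E) 𝓘(𝕜, E') ω f x) :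
    ∃ (s : E → M) (y : E) (D : E →L[𝕜] E'), s y = x ∧ Function.Injective D ∧
      HasFDerivAt (fun z => chartAt E' (f x) (f (s z))) D y ∧
      (∀ᶠ z in 𝓝 y, DifferentiableAt 𝕜 (fun z => chartAt E' (f x) (f (s z))) z) ∧
      ∀ᶠ z in 𝓝 y, f (s z) ∈ (chartAt E' (f x)).source := by
  set φ := hf.domChart
  set ψ := hf.codChart
  set c := chartAt E' (f x)
  -- In the charts adapted to the immersion, `f` is this linear injection; it remains to pass from
  -- `ψ` to the preferred chart `c`.
  let j : E →L[𝕜] E' := (hf.equiv : (E × hf.complement) →L[𝕜] E').comp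
    (ContinuousLinearMap.inl 𝕜 E hf.complement)
  have hj : Function.Injective j := hf.equiv.injective.comp
    (fun a b h => by simpa using h)
  have hxφ : x ∈ φ.source := hf.mem_domChart_source
  have hxψ : f x ∈ ψ.source := hf.mem_codChart_source
  have hwr : ∀ z ∈ φ.target, ψ (f (φ.symm z)) = j z := by
    intro z hz
    have hz' : z ∈ (φ.extend 𝓘(𝕜, E)).target := by simpa using hz
    exact hf.writtenInCharts hz'
  have hfs : ∀ z ∈ φ.target, f (φ.symm z) = ψ.symm (j z) := by
    intro z hz
    rw [← hwr z hz, ψ.left_inv]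
    exact hf.source_subset_preimage_source (φ.map_target hz)
  set y := φ x
  have hy : y ∈ φ.target := φ.map_source hxφ
  have hsy : φ.symm y = x := φ.left_inv hxφ
  have hjy : j y = ψ (f x) := by rw [← hwr y hy, hsy]
  have hjy' : j y ∈ ψ.target := hjy ▸ ψ.map_source hxψ
  have hxc : f x ∈ c.source := mem_chart_source _ _
  have hψc : ψ ∈ IsManifold.maximalAtlas 𝓘(𝕜, E') ω N := hf.codChart_mem_maximalAtlas
  have hcc : c ∈ IsManifold.maximalAtlas 𝓘(𝕜, E') ω N := IsManifold.chart_mem_maximalAtlas _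
  have htr : ∀ {a b : OpenPartialHomeomorph N E'},
      a ∈ IsManifold.maximalAtlas 𝓘(𝕜, E') ω N → b ∈ IsManifold.maximalAtlas 𝓘(𝕜, E') ω N →
      ∀ e ∈ a.target, a.symm e ∈ b.source → DifferentiableAt 𝕜 (fun e => b (a.symm e)) e := by
    intro a b ha hb e he heb
    have h1 := (contMDiffOn_symm_of_mem_maximalAtlas ha).contMDiffAt (a.open_target.mem_nhds he)
    have h2 := (contMDiffOn_of_mem_maximalAtlas hb).contMDiffAt (b.open_source.mem_nhds heb)
    have h3 := (h2.comp e h1).contDiffAt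
    exact h3.differentiableAt (by simp)
  have hcont : ContinuousAt (fun z => ψ.symm (j z)) y :=
    (ψ.continuousAt_symm hjy').comp j.continuous.continuousAt
  have hψy : ψ.symm (j y) = f x := by rw [hjy, ψ.left_inv hxψ]
  have hsrc : ∀ᶠ z in 𝓝 y, ψ.symm (j z) ∈ c.source :=
    hcont.eventually_mem (c.open_source.mem_nhds (hψy ▸ hxc))
  have htgt : ∀ᶠ z in 𝓝 y, j z ∈ ψ.target :=
    j.continuous.continuousAt.eventually_mem (ψ.open_target.mem_nhds hjy')
  have hev : ∀ᶠ z in 𝓝 y, f (φ.symm z) = ψ.symm (j z) :=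
    (φ.open_target.eventually_mem hy).mono hfs
  have hdiff : ∀ᶠ z in 𝓝 y, DifferentiableAt 𝕜 (fun z => c (f (φ.symm z))) z := by
    filter_upwards [hev.eventually_nhds, hsrc, htgt] with z h1 h2 h3
    refine DifferentiableAt.congr_of_eventuallyEq (f := fun z => c (ψ.symm (j z))) ?_
      (h1.mono fun w hw => by simp only [hw])
    exact (htr hψc hcc (j z) h3 h2).comp z j.differentiableAt
  refine ⟨φ.symm, y, _, hsy, ?_, hdiff.self_of_nhds.hasFDerivAt, hdiff, ?_⟩
  -- Composing with the transition from `c` back to `ψ` recovers `j`. By the chain rule `j` factors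
  -- through the derivative, which is therefore injective.
  · have hcx : c (f (φ.symm y)) = c (f x) := by rw [hsy]
    have hback : DifferentiableAt 𝕜 (fun e => ψ (c.symm e)) (c (f (φ.symm y))) := by
      refine htr hcc hψc _ ?_ ?_
      · rw [hcx]; exact c.map_source hxc
      · rw [hcx, c.left_inv hxc]; exact hxψ
    have hcomp := hback.hasFDerivAt.comp y hdiff.self_of_nhds.hasFDerivAt
    have hj' : HasFDerivAt (fun z => ψ (c.symm (c (f (φ.symm z))))) j y := by
      refine j.hasFDerivAt.congr_of_eventuallyEq ?_
      filter_upwards [hev, hsrc, htgt] with z h1 h2 h3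
      rw [h1, c.left_inv h2, ψ.right_inv h3]
    have := hcomp.unique hj'
    intro a b hab
    apply hj
    rw [← this]
    simp only [ContinuousLinearMap.comp_apply, hab]
  · filter_upwards [hev, hsrc] with z h1 h2
    rwa [h1]

/-! ### The projection to the projective line and the norm ratio -/

namespace PeriodSpace

variable {n : ℕ}

/-- The coordinate vector with its Euclidean norm. -/
noncomputable def toEuclidean (n : ℕ) : CVec n →L[ℂ] EuclideanSpace ℂ (Fin 3 ⊕ Fin n) :=
  (EuclideanSpace.equiv (Fin 3 ⊕ Fin n) ℂ).symm.toContinuousLinearMap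

theorem toEuclidean_injective : Function.Injective (toEuclidean n) :=
  (EuclideanSpace.equiv (Fin 3 ⊕ Fin n) ℂ).symm.injective

/-- The second and third positive coordinates. -/
noncomputable def posPair (n : ℕ) : CVec n →L[ℂ] EuclideanSpace ℂ (Fin 2) :=
  (EuclideanSpace.equiv (Fin 2) ℂ).symm.toContinuousLinearMap.comp
    (ContinuousLinearMap.pi fun i => ContinuousLinearMap.proj (Sum.inl i.succ))

theorem posPair_apply (v : CVec n) (i : Fin 2) : posPair n v i = v (Sum.inl i.succ) := rfl

/-- The projection away from a positive line is defined on all of the period space. -/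
theorem IsPosNull.posPair_ne_zero {v : CVec n} (hv : IsPosNull v) : posPair n v ≠ 0 := by
  intro h
  have h1 : v (Sum.inl 1) = 0 := congrArg (fun w : EuclideanSpace ℂ (Fin 2) => w 0) h
  have h2 : v (Sum.inl 2) = 0 := congrArg (fun w : EuclideanSpace ℂ (Fin 2) => w 1) h
  obtain ⟨hnull, hpos⟩ := hv
  rw [form_apply, Fin.sum_univ_three, h1, h2] at hnull hpos
  have hsq : v (Sum.inl 0) ^ 2 = ∑ j : Fin n, v (Sum.inr j) ^ 2 := by
    simp only [pow_two]
    linear_combination hnull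
  -- Nullity and the triangle inequality bound the remaining positive coordinate by the negative
  -- ones, so ⟨v, v̄⟩ ≤ 0.
  have hle : ‖v (Sum.inl 0)‖ ^ 2 ≤ ∑ j : Fin n, ‖v (Sum.inr j)‖ ^ 2 := by
    rw [← norm_pow, hsq]
    exact (norm_sum_le _ _).trans_eq (by simp only [norm_pow])
  have hre : ∀ z : ℂ, (z * star z).re = ‖z‖ ^ 2 := fun z => by
    rw [← Complex.normSq_eq_norm_sq, ← Complex.ofReal_re (Complex.normSq z), ← Complex.mul_conj]
    rfl
  simp only [Pi.star_apply, zero_mul, add_zero, Complex.sub_re, Complex.re_sum, hre] at hpos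
  linarith

/-- The ratio of the norms of `v` and of its projection, a function on the period space. -/
noncomputable def normRatio (v : CVec n) : ℝ := ‖toEuclidean n v‖ / ‖posPair n v‖

theorem normRatio_smul {a : ℂ} (ha : a ≠ 0) (v : CVec n) : normRatio (a • v) = normRatio v := by
  rw [normRatio, map_smul, map_smul, norm_smul, norm_smul,
    mul_div_mul_left _ _ (norm_ne_zero_iff.2 ha), normRatio]

/-- The chosen representative `q.rep` need not vary continuously with `q`. By scale invariance it
can be traded for the lift `param p (chart p q)`, which is holomorphic in the chart. -/
theorem normRatio_rep_eq (p : PeriodSpace n) {q : PeriodSpace n} (hq : q ∈ (chart p).source) :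
    normRatio q.rep = normRatio (param p (chart p q)) := by
  have h : form n q.rep (star p.rep) ≠ 0 := hq
  change _ = normRatio (param p (coord p q.rep))
  rw [param_coord p q.isPosNull_rep.1 h, normRatio_smul (inv_ne_zero h)]

theorem isPosNull_param_chart (p : PeriodSpace n) {q : PeriodSpace n}
    (hq : q ∈ (chart p).source) : IsPosNull (param p (chart p q)) :=
  ⟨form_param_param _ _, (chart p).map_source hq⟩

theorem continuous_normRatio_rep : Continuous fun q : PeriodSpace n => normRatio q.rep := by
  rw [continuous_iff_continuousAt]
  intro p
  have hp : p ∈ (chart p).source := form_rep_ne_zero p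
  have h1 : ContinuousAt (fun q => param p (chart p q)) p :=
    (contDiff_param p).continuous.continuousAt.comp ((chart p).continuousAt hp)
  have h2 : ContinuousAt (fun q => normRatio (param p (chart p q))) p :=
    ((toEuclidean n).continuous.continuousAt.comp h1).norm.div
      ((posPair n).continuous.continuousAt.comp h1).norm
      (norm_ne_zero_iff.2 (isPosNull_param_chart p hp).posPair_ne_zero)
  refine h2.congr ?_
  filter_upwards [(chart p).open_source.mem_nhds hp] with q hq
  exact (normRatio_rep_eq p hq).symm

/-- The chart coordinate is thus a linear function of the normalized lift, so derivatives of the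
lift determine those of the coordinate. -/
theorem coordT_param (p : PeriodSpace n) (e : EuclideanSpace ℂ (Fin (n + 1))) :
    coordT p (param p e) = e := by
  have := coord_param p e
  rwa [coord, form_param, inv_one, one_smul] at this

theorem chart_self (p : PeriodSpace n) : chart p p = 0 := by
  change coord p p.rep = 0
  rw [coord, coordT_rep, smul_zero]

end PeriodSpace

/-! ### The maximum point and the contradiction -/

open PeriodSpace

/-- The period space `Gr₊₊(ℝ^{3,n})` contains no compact complex submanifold of dimension
greater than `1`: a nonempty compact complex manifold `X` of dimension `d` which is
holomorphically embedded in it has `d ≤ 1`. -/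
theorem mainTheorem3 (n d : ℕ) (X : Type*) [TopologicalSpace X] [CompactSpace X] [Nonempty X]
    [ChartedSpace (EuclideanSpace ℂ (Fin d)) X]
    [IsManifold 𝓘(ℂ, EuclideanSpace ℂ (Fin d)) ω X]
    (ι : X → PeriodSpace n)
    (hι : Manifold.IsSmoothEmbedding 𝓘(ℂ, EuclideanSpace ℂ (Fin d))
      𝓘(ℂ, EuclideanSpace ℂ (Fin (n + 1))) ω ι) :
    d ≤ 1 := by
  by_contra! hd
  obtain ⟨x, -, hx⟩ := isCompact_univ.exists_isMaxOn Set.univ_nonempty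
    (continuous_normRatio_rep.comp hι.isEmbedding.continuous).continuousOn
  set p := ι x with hp
  obtain ⟨s, y, D, hsy, hD, hderiv, hdiff, hsrc⟩ :=
    (hι.isImmersion.isImmersionAt x).exists_hasFDerivAt_injective
  change HasFDerivAt (fun z => chart p (ι (s z))) D y at hderiv
  change ∀ᶠ z in 𝓝 y, DifferentiableAt ℂ (fun z => chart p (ι (s z))) z at hdiff
  change ∀ᶠ z in 𝓝 y, ι (s z) ∈ (chart p).source at hsrc
  -- Local holomorphic lift of `ι` near the maximum point, normalized by ⟨V, p̄⟩ = 1.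
  let V : EuclideanSpace ℂ (Fin d) → CVec n := fun z => param p (chart p (ι (s z)))
  have hparam : Differentiable ℂ (param p) := (contDiff_param p).differentiable (by simp)
  have hVdiff : ∀ᶠ z in 𝓝 y, DifferentiableAt ℂ V z :=
    hdiff.mono fun z hz => (hparam _).comp z hz
  obtain ⟨V', hV'⟩ := hVdiff.self_of_nhds
  have hVy : IsPosNull (V y) := isPosNull_param_chart p hsrc.self_of_nhds
  have hTV : coordT p (V y) = 0 := by
    change coordT p (param p (chart p (ι (s y)))) = 0
    rw [coordT_param, hsy, ← hp, chart_self]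
  have hTV' : ∀ w, coordT p (V' w) = D w := by
    have h1 : HasFDerivAt (fun z => coordT p (V z)) ((coordT p).comp V') y :=
      (coordT p).hasFDerivAt.comp y hV'
    have h2 : (fun z => coordT p (V z)) = fun z => chart p (ι (s z)) :=
      funext fun z => coordT_param p _
    rw [h2] at h1
    exact fun w => congrArg (fun L : _ →L[ℂ] _ => L w) (h1.unique hderiv)
  set u₀ := posPair n (V y) with hu₀
  have hu₀0 : u₀ ≠ 0 := hVy.posPair_ne_zero
  -- A nonzero tangent vector killed by the differential of the projection to the projective line.
  -- The tangent space of that line is modelled on ℂ² / ℂ`u₀`, of dimension 1 < `d`; this is where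
  -- `d` ≥ 2 enters.
  obtain ⟨w, hw, hw0⟩ : ∃ w, posPair n (V' w) ∈ Submodule.span ℂ {u₀} ∧ w ≠ 0 := by
    have hlt : Module.finrank ℂ (EuclideanSpace ℂ (Fin 2) ⧸ Submodule.span ℂ {u₀}) <
        Module.finrank ℂ (EuclideanSpace ℂ (Fin d)) := by
      have := Submodule.finrank_quotient_add_finrank (Submodule.span ℂ {u₀})
      rw [finrank_span_singleton hu₀0, finrank_euclideanSpace_fin] at this
      rw [finrank_euclideanSpace_fin]
      omega
    have hker := LinearMap.ker_ne_bot_of_finrank_lt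
      (f := (Submodule.span ℂ {u₀}).mkQ ∘ₗ ((posPair n).comp V').toLinearMap) hlt
    obtain ⟨w, hw, hw0⟩ := (Submodule.ne_bot_iff _).1 hker
    refine ⟨w, ?_, hw0⟩
    rw [LinearMap.mem_ker, LinearMap.comp_apply, Submodule.mkQ_apply,
      Submodule.Quotient.mk_eq_zero] at hw
    exact hw
  let l : ℂ → EuclideanSpace ℂ (Fin d) := fun t => y + t • w
  have hl0 : l 0 = y := by simp [l]
  have hl : ∀ t, HasDerivAt l w t := fun t => by
    have := ((hasDerivAt_id t).smul_const w).const_add y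
    rwa [one_smul] at this
  have hlt : Filter.Tendsto l (𝓝 0) (𝓝 y) := hl0 ▸ (hl 0).continuousAt
  have hline : HasDerivAt (fun t => V (l t)) (V' w) 0 :=
    HasFDerivAt.comp_hasDerivAt (f := l) (l := V) (0 : ℂ) (by rwa [hl0]) (hl 0)
  have hlined : ∀ᶠ t in 𝓝 (0 : ℂ), DifferentiableAt ℂ (fun t => V (l t)) t :=
    (hlt.eventually hVdiff).mono fun t ht => ht.comp t (hl t).differentiableAt
  -- Along the complex line through `y` in direction `w`, the projection is stationary to first
  -- order and the norm ratio is maximal at `0`.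
  have key := deriv_mem_span_of_norm_ratio_le
    (v := fun t => toEuclidean n (V (l t))) (u := fun t => posPair n (V (l t)))
    (hlined.mono fun t ht => (toEuclidean n).differentiableAt.comp t ht)
    (hlined.mono fun t ht => (posPair n).differentiableAt.comp t ht)
    ((toEuclidean n).hasFDerivAt.comp_hasDerivAt 0 hline)
    ((posPair n).hasFDerivAt.comp_hasDerivAt 0 hline)
    (by rw [hl0]; exact fun h => hVy.ne_zero (toEuclidean_injective (h.trans (map_zero _).symm)))
    (by rw [hl0]; exact hu₀0) (by rw [hl0]; exact hw)
    (by
      filter_upwards [hlt.eventually hsrc] with t ht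
      have hmax : normRatio (ι (s (l t))).rep ≤ normRatio (ι x).rep := hx (Set.mem_univ (s (l t)))
      rw [normRatio_rep_eq p ht, ← hsy, normRatio_rep_eq p hsrc.self_of_nhds] at hmax
      change normRatio (V (l t)) ≤ normRatio (V y) at hmax
      have hVt : IsPosNull (V (l t)) := isPosNull_param_chart p ht
      rw [hl0]
      exact (div_le_div_iff₀ (norm_pos_iff.2 hVt.posPair_ne_zero) (norm_pos_iff.2 hu₀0)).1 hmax)
  -- So `V' w` is a multiple of `V y`, which `coordT p` kills. As `coordT p` sends `V' w` to `D w`,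
  -- injectivity of `D` forces `w = 0`.
  obtain ⟨a, ha⟩ := Submodule.mem_span_singleton.1 key
  rw [hl0, ← map_smul] at ha
  have h1 := congrArg (coordT p) (toEuclidean_injective ha)
  rw [map_smul, hTV, smul_zero, hTV'] at h1
  exact hw0 (hD (h1.symm.trans (map_zero D).symm))
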